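/- An $n$-port resistive network consists of finitely many nodes, $n$ ports and finitely many resistors (elements), where every port and every element is an oriented edge joining two distinct nodes (parallel edges are allowed) and every element has a conductance $g_e>0$. Its augmented graph is the graph whose vertices are the nodes and whose edges are all the ports and all the elements; it is assumed to be connected. Port voltages $v\in\mathbb{R}^n$ and port currents $i\in\mathbb{R}^n$ are compatible with the network if there are node potentials such that each $v_k$ is the potential difference across port $k$, and the element currents, given by Ohm's law (conductance times potential difference), satisfy Kirchhoff's current law at every node together with the port currents. A real $n\times n$ matrix $Y$ is the admittance of the network if, for all $v,i\in\mathbb{R}^n$, the pair $(v,i)$ is compatible with the network if and only if $i=Yv$. **Theorem 1.** A real symmetric matrix $$Y=\begin{bmatrix} y_{11}&y_{12}&y_{13}\\ y_{12}&y_{22}&y_{23}\\ y_{13}&y_{23}&y_{33}\end{bmatrix}$$ is the admittance of a three-port resistive network with (connected augmented graph and) at most three elements if and only if at least one of the following two conditions holds: 1. $y_{12}y_{13}y_{23}\le 0$, $\;y_{11}-|y_{12}|-|y_{13}|\ge 0$, $\;y_{22}-|y_{12}|-|y_{23}|\ge 0$, $\;y_{33}-|y_{13}|-|y_{23}|\ge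 0$, and at least three of the six numbers $y_{12}$, $y_{13}$, $y_{23}$, $y_{11}-|y_{12}|-|y_{13}|$, $y_{22}-|y_{12}|-|y_{23}|$, $y_{33}-|y_{13}|-|y_{23}|$ are zero. 2. $y_{12}y_{13}y_{23}\ge 0$, and at least one of the following three lists of six inequalities holds, with equality in at least three of the six inequalities of that list: - (a) $-|y_{13}|\le 0$, $\;|y_{13}|\le|y_{12}|\le y_{11}$, $\;|y_{13}|\le|y_{23}|\le y_{33}$, $\;|y_{12}|+|y_{23}|-|y_{13}|\le y_{22}$; - (b) $-|y_{12}|\le 0$, $\;|y_{12}|\le|y_{13}|\le y_{11}$, $\;|y_{12}|\le|y_{23}|\le y_{22}$, $\;|y_{13}|+|y_{23}|-|y_{12}|\le y_{33}$; - (c) $-|y_{23}|\le 0$, $\;|y_{23}|\le|y_{12}|\le y_{22}$, $\;|y_{23}|\le|y_{13}|\le y_{33}$, $\;|y_{12}|+|y_{13}|-|y_{23}|\le y_{11}$. -/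

import Mathlib

open scoped Matrix

/-- An `n`-port resistive network without transformers: a finite set of nodes, `n` ports and finitely
many resistors, each of them an oriented edge between two different nodes (parallel edges are
allowed), and a positive conductance for every resistor. The edge `(a, b)` is oriented from its
positive terminal `a` to its negative terminal `b`. -/
structure ResistiveNetwork (n : ℕ) where
  /-- the number of nodes -/
  numNodes : ℕ
  /-- the number of elements -/
  numElements : ℕ
  /-- the terminals of the ports -/
  port : Fin n → Fin numNodes × Fin numNodes
  /-- the terminals of the elements -/
  element : Fin numElements → Fin numNodes × Fin numNodes
  /-- the conductances of the elements -/
  conductance : Fin numElements → ℝ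
  port_ne : ∀ k, (port k).1 ≠ (port k).2
  element_ne : ∀ e, (element e).1 ≠ (element e).2
  conductance_pos : ∀ e, 0 < conductance e

namespace ResistiveNetwork

/-- The incidence coefficient of an oriented edge at a node: `1` at the positive terminal,
`-1` at the negative terminal, and `0` elsewhere. -/
def incidence {V : Type} [DecidableEq V] (edge : V × V) (x : V) : ℝ :=
  (if edge.1 = x then 1 else 0) - (if edge.2 = x then 1 else 0)

/-- The augmented graph (up to orientation and multiplicity of edges): the vertices are the nodes,
and every port and every element contributes an edge. -/
def augmentedGraph {n : ℕ} (N : ResistiveNetwork n) : SimpleGraph (Fin N.numNodes) :=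
  SimpleGraph.fromRel fun x y => (∃ k, N.port k = (x, y)) ∨ (∃ e, N.element e = (x, y))

/-- The port voltages `v` and port currents `i` are compatible with the network: there are node
potentials `p` and element currents `j` such that the port voltages are the potential differences
across the ports (Kirchhoff's voltage law), every element obeys Ohm's law, and at every node the
total current injected through the ports equals the total current leaving through the elements
(Kirchhoff's current law). The current `i k` enters the network at the positive terminal of port `k`
and leaves it at the negative one. -/
def Compatible {n : ℕ} (N : ResistiveNetwork n) (v i : Fin n → ℝ) : Prop :=
  ∃ (p : Fin N.numNodes → ℝ) (j : Fin N.numElements → ℝ),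
    (∀ k, v k = p (N.port k).1 - p (N.port k).2) ∧
    (∀ e, j e = N.conductance e * (p (N.element e).1 - p (N.element e).2)) ∧
    (∀ x, ∑ k, i k * incidence (N.port k) x = ∑ e, j e * incidence (N.element e) x)

/-- `Y` is the admittance of the network: every vector `v` of port voltages can be imposed, and the
port currents are then uniquely determined and equal to `Y v`. -/
def HasAdmittance {n : ℕ} (N : ResistiveNetwork n) (Y : Matrix (Fin n) (Fin n) ℝ) : Prop :=
  ∀ v i : Fin n → ℝ, N.Compatible v i ↔ i = Y *ᵥ v

end ResistiveNetwork

/-- `Y` is the admittance of an `n`-port resistive network with a connected augmented graph and at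
most `m` elements. -/
def RealizableWithAtMost {n : ℕ} (m : ℕ) (Y : Matrix (Fin n) (Fin n) ℝ) : Prop :=
  ∃ N : ResistiveNetwork n,
    N.augmentedGraph.Connected ∧ N.numElements ≤ m ∧ N.HasAdmittance Y

/-- At least three of the six numbers `q 0, …, q 5` are zero. -/
def AtLeastThreeZero (q : Fin 6 → ℝ) : Prop :=
  3 ≤ (Finset.univ.filter fun k => q k = 0).card

/-- The six inequalities `l k ≤ r k` all hold, at least three of them with equality. -/
def HoldWithThreeEqualities (l r : Fin 6 → ℝ) : Prop :=
  (∀ k, l k ≤ r k) ∧ 3 ≤ (Finset.univ.filter fun k => l k = r k).card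

/-! Pairing Kirchhoff's current law with a test potential turns the network equations into a weak
form that involves only potential drops (`WeakRealizes`). Every voltage vector is attained, so the
three ports are independent edges and there are at least four nodes. If there are five or more, some
nonconstant potential has zero drop along every port, and a level set S of it is a cut that no port
crosses. The net element current through this cut is zero, and the potential on S may be shifted
freely. Hence a node of S can be identified with a node outside, after the crossing elements are
replaced by equivalent ones: by the series law if at most two cross, by star-delta if all three do
(`exists_smaller`). So four nodes suffice, still with three elements.

On four nodes the ports form a spanning tree: a star, or a path with one of three middle ports. The
potentials dual to the ports write Y as a sum over the six node pairs, at least three of which carry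
conductance zero (`TreeForm`). For each shape the six conductances are linear in the diagonal
entries and the absolute values of the others. Their nonnegativity gives the inequalities and their
vanishing the equalities; the sign condition on y12 y13 y23 is what is invariant under reorienting
ports. The star gives condition 1, the paths condition 2. Conversely, such conductances on such a
tree define a network. -/

/-! ### Weak form of the network equations -/

/-- The difference of the values of `f` at the two ends of an edge. -/
def drop {V : Type} (f : V → ℝ) (e : V × V) : ℝ := f e.1 - f e.2

/-- The variational form of the network equations, for three ports and three elements, where the
conductances may vanish and the elements may be loops. -/
def WeakRealizes {V : Type} (q r : Fin 3 → V × V) (g : Fin 3 → ℝ)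
    (Y : Matrix (Fin 3) (Fin 3) ℝ) : Prop :=
  (∀ e, 0 ≤ g e) ∧ ∀ v : Fin 3 → ℝ, ∃ p : V → ℝ, (∀ k, drop p (q k) = v k) ∧
    ∀ f : V → ℝ, ∑ k, (Y *ᵥ v) k * drop f (q k) = ∑ e, g e * drop p (r e) * drop f (r e)

lemma sum_incidence_mul {V : Type} [Fintype V] [DecidableEq V] (e : V × V) (f : V → ℝ) :
    ∑ x, ResistiveNetwork.incidence e x * f x = drop f e := by
  simp [ResistiveNetwork.incidence, drop, sub_mul, Finset.sum_sub_distrib]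

/-- Summation by parts: the current law at each node is multiplied by `f` there and summed over the
nodes. -/
lemma ResistiveNetwork.HasAdmittance.exists_potential {n : ℕ} {N : ResistiveNetwork n}
    {Y : Matrix (Fin n) (Fin n) ℝ} (h : N.HasAdmittance Y) (v : Fin n → ℝ) :
    ∃ p : Fin N.numNodes → ℝ, (∀ k, drop p (N.port k) = v k) ∧
      ∀ f : Fin N.numNodes → ℝ, ∑ k, (Y *ᵥ v) k * drop f (N.port k) =
        ∑ e, N.conductance e * drop p (N.element e) * drop f (N.element e) := by
  obtain ⟨p, j, hp, hj, hk⟩ := (h v (Y *ᵥ v)).2 rfl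
  refine ⟨p, fun k => (hp k).symm, fun f => ?_⟩
  have := Finset.sum_congr (rfl : (Finset.univ : Finset (Fin N.numNodes)) = Finset.univ)
    (fun x _ => congrArg (· * f x) (hk x))
  simp only [Finset.sum_mul] at this
  rw [Finset.sum_comm] at this
  conv_rhs at this => rw [Finset.sum_comm]
  simp only [mul_assoc, ← Finset.mul_sum, sum_incidence_mul] at this
  rw [this]
  refine Finset.sum_congr rfl fun e _ => ?_
  rw [hj e, drop, drop]

lemma ResistiveNetwork.HasAdmittance.weakRealizes {N : ResistiveNetwork 3}
    {Y : Matrix (Fin 3) (Fin 3) ℝ} (h : N.HasAdmittance Y) (hm : N.numElements ≤ 3) :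
    ∃ r g, WeakRealizes N.port r g Y := by
  obtain ⟨d, hd⟩ := Nat.exists_eq_add_of_le hm
  let σ : Fin 3 ≃ Fin (N.numElements + d) := finCongr hd
  -- Missing elements are padded with copies of port 0 of conductance zero.
  refine ⟨fun e => Fin.append N.element (fun _ => N.port 0) (σ e),
    fun e => Fin.append N.conductance (fun _ => 0) (σ e), fun e => ?_, fun v => ?_⟩
  · show 0 ≤ Fin.append N.conductance (fun _ => 0) (σ e)
    generalize σ e = i
    induction i using Fin.addCases with
    | left i => simpa using (N.conductance_pos i).le
    | right i => simp
  · obtain ⟨p, hp, hf⟩ := h.exists_potential v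
    refine ⟨p, hp, fun f => ?_⟩
    rw [hf f, Equiv.sum_comp σ (fun i => Fin.append N.conductance (fun _ => 0) i *
      drop p (Fin.append N.element (fun _ => N.port 0) i) *
      drop f (Fin.append N.element (fun _ => N.port 0) i)), Fin.sum_univ_add]
    simp

/-! ### Identifying nodes across a cut -/

namespace WeakRealizes

variable {V : Type} {q r : Fin 3 → V × V} {g : Fin 3 → ℝ} {Y : Matrix (Fin 3) (Fin 3) ℝ}

lemma perm (h : WeakRealizes q r g Y) (σ : Equiv.Perm (Fin 3)) :
    WeakRealizes q (r ∘ σ) (g ∘ σ) Y := by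
  refine ⟨fun e => h.1 _, fun v => ?_⟩
  obtain ⟨p, hp, hf⟩ := h.2 v
  refine ⟨p, hp, fun f => ?_⟩
  rw [hf f, ← Equiv.sum_comp σ]
  rfl

lemma reorient (h : WeakRealizes q r g Y) {r' : Fin 3 → V × V}
    (hr : ∀ e, r' e = r e ∨ r' e = (r e).swap) : WeakRealizes q r' g Y := by
  refine ⟨h.1, fun v => ?_⟩
  obtain ⟨p, hp, hf⟩ := h.2 v
  refine ⟨p, hp, fun f => ?_⟩
  rw [hf f]
  refine Finset.sum_congr rfl fun e _ => ?_
  rcases hr e with h | h <;> rw [h]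
  simp only [drop, Prod.fst_swap, Prod.snd_swap]
  ring

open Classical in
/-- Identify a node `a` of a port-closed set `S` with a node `b` outside `S`, replacing the elements
by equivalent ones. -/
lemma glue (h : WeakRealizes q r g Y) {S : Set V} (hS : ∀ k, (q k).1 ∈ S ↔ (q k).2 ∈ S)
    {a b : V} (ha : a ∈ S) (hb : b ∉ S) (r' : Fin 3 → V × V) (g' : Fin 3 → ℝ)
    (hg' : ∀ e, 0 ≤ g' e)
    (heq : ∀ p f : V → ℝ, ∑ e, g e * drop p (r e) * drop (S.indicator 1) (r e) = 0 →
      f a = f b → ∑ e, g e * drop p (r e) * drop f (r e) =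
        ∑ e, g' e * drop (fun x => p x - (p a - p b) * S.indicator 1 x) (r' e) * drop f (r' e)) :
    ∃ (q₁ r₁ : Fin 3 → {x // x ≠ b} × {x // x ≠ b}), WeakRealizes q₁ r₁ g' Y := by
  have hab : a ≠ b := fun h => hb (h ▸ ha)
  let γ : V → {x // x ≠ b} := fun x => if hx : x = b then ⟨a, hab⟩ else ⟨x, hx⟩
  refine ⟨fun k => Prod.map γ γ (q k), fun e => Prod.map γ γ (r' e), hg', fun v => ?_⟩
  obtain ⟨p, hp, hf⟩ := h.2 v
  -- The shift on `S` makes the potentials at `a` and `b` agree, so `p'` descends to the quotient;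
  -- port voltages do not change.
  set p' : V → ℝ := fun x => p x - (p a - p b) * S.indicator 1 x with hp'
  have hq1 : ∀ k, drop (S.indicator (1 : V → ℝ)) (q k) = 0 := fun k => by
    by_cases h1 : (q k).1 ∈ S
    · simp [drop, h1, (hS k).1 h1]
    · simp [drop, h1, mt (hS k).2 h1]
  have hdrop : ∀ (f : {x // x ≠ b} → ℝ) (e : V × V),
      drop f (Prod.map γ γ e) = drop (f ∘ γ) e := fun f e => rfl
  have hpγ : (fun x : {x // x ≠ b} => p' x) ∘ γ = p' := by
    funext x
    by_cases hx : x = b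
    · subst hx
      simp [γ, hp', ha, hb]
    · simp [γ, hx]
  refine ⟨fun x => p' x, fun k => ?_, fun f => ?_⟩
  · rw [hdrop, hpγ, ← hp k]
    have := hq1 k
    simp only [drop, hp'] at this ⊢
    linear_combination -(p a - p b) * this
  -- Testing with the indicator of `S`: no net current crosses the cut.
  · have h0 := hf (S.indicator 1)
    simp only [hq1, mul_zero, Finset.sum_const_zero] at h0
    have := heq p (f ∘ γ) h0.symm (by simp [γ, hab])
    simp only [hdrop, hpγ]
    rw [hf, this]

/-- Reduction across a port-closed set that some element does not cross. -/
lemma glue_of_not_cross (h : WeakRealizes q r g Y) {S : Set V}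
    (hS : ∀ k, (q k).1 ∈ S ↔ (q k).2 ∈ S) (hne : S.Nonempty) (hne' : Sᶜ.Nonempty)
    {e₀ : Fin 3} (he₀ : (r e₀).1 ∈ S ↔ (r e₀).2 ∈ S) :
    ∃ (b : V) (q₁ r₁ : Fin 3 → {x // x ≠ b} × {x // x ≠ b}) (g₁ : Fin 3 → ℝ),
      WeakRealizes q₁ r₁ g₁ Y := by
  classical
  -- Elements are oriented out of `S` and numbered so that the crossing ones come first.
  wlog hor : ∀ e, (r e).2 ∈ S → (r e).1 ∈ S generalizing r
  · refine this (r := fun e => if (r e).2 ∈ S then (if (r e).1 ∈ S then r e else (r e).swap)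
      else r e) (h.reorient fun e => ?_) ?_ fun e => ?_
    · split_ifs <;> simp
    · split_ifs <;> simp_all
    · split_ifs <;> simp_all
  wlog h2 : e₀ = 2 generalizing r g e₀
  · refine this (r := r ∘ Equiv.swap e₀ 2) (g := g ∘ Equiv.swap e₀ 2) (e₀ := 2)
      (h.perm _) ?_ (fun e => hor _) rfl
    simpa using he₀
  subst h2
  wlog h01 : ((r 1).1 ∈ S ∧ (r 1).2 ∉ S) → ((r 0).1 ∈ S ∧ (r 0).2 ∉ S) generalizing r g
  · refine this (r := r ∘ Equiv.swap 0 1) (g := g ∘ Equiv.swap 0 1)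
      (h.perm _) (fun e => hor _) ?_ ?_
    · simpa [Equiv.swap_apply_of_ne_of_ne] using he₀
    · push Not at h01
      intro _
      simpa using h01.1
  have hchi : ∀ e, ((r e).1 ∈ S ↔ (r e).2 ∈ S) → drop (S.indicator (1 : V → ℝ)) (r e) = 0 := by
    intro e he
    by_cases h1 : (r e).1 ∈ S
    · simp [drop, h1, he.1 h1]
    · simp [drop, h1, mt he.2 h1]
  have hchi1 : ∀ e, ((r e).1 ∈ S ∧ (r e).2 ∉ S) → drop (S.indicator (1 : V → ℝ)) (r e) = 1 := by
    intro e he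
    simp [drop, he.1, he.2]
  have hsub : ∀ (p : V → ℝ) (c : ℝ) (e : V × V),
      drop (fun x => p x - c * S.indicator 1 x) e = drop p e - c * drop (S.indicator 1) e := by
    intro p c e
    simp only [drop]
    ring
  have hnc : ∀ e, ¬ ((r e).1 ∈ S ∧ (r e).2 ∉ S) → ((r e).1 ∈ S ↔ (r e).2 ∈ S) := by
    intro e he
    have := hor e
    tauto
  by_cases c0 : (r 0).1 ∈ S ∧ (r 0).2 ∉ S
  · refine ⟨(r 0).2, ?_⟩
    by_cases c1 : (r 1).1 ∈ S ∧ (r 1).2 ∉ S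
    -- Two crossing elements carry opposite currents and act in series: element 0 is contracted and
    -- element 1 receives the series conductance.
    · obtain ⟨q₁, r₁, h₁⟩ := h.glue hS c0.1 c0.2 r ![0, g 0 * g 1 / (g 0 + g 1), g 2] (by
          have h0 := h.1 0
          have h1 := h.1 1
          have h2 := h.1 2
          intro e
          fin_cases e <;> simp <;> positivity) (by
          intro p f h0 hab
          simp only [Fin.sum_univ_three, hsub, hchi _ he₀, hchi1 _ c0, hchi1 _ c1] at h0 ⊢
          have hf0 : drop f (r 0) = 0 := by simp [drop, hab]
          have hp0 : p (r 0).1 - p (r 0).2 = drop p (r 0) := rfl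
          simp only [hf0, hp0]
          have key : g 1 * drop p (r 1) =
              g 0 * g 1 / (g 0 + g 1) * (drop p (r 1) - drop p (r 0)) := by
            have p0 := h.1 0
            have p1 := h.1 1
            by_cases hz : g 0 + g 1 = 0
            · have : g 1 = 0 := by linarith
              simp [this]
            · field_simp
              linear_combination g 1 * h0
          simp [key])
      exact ⟨q₁, r₁, _, h₁⟩
    -- A single crossing element becomes a loop when its ends are identified.
    · obtain ⟨q₁, r₁, h₁⟩ := h.glue hS c0.1 c0.2 r g h.1 (by
          intro p f h0 hab
          simp only [Fin.sum_univ_three, hsub, hchi _ he₀, hchi1 _ c0, hchi _ (hnc 1 c1)] at h0 ⊢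
          have hf0 : drop f (r 0) = 0 := by simp [drop, hab]
          simp [hf0])
      exact ⟨q₁, r₁, _, h₁⟩
  · obtain ⟨a, ha⟩ := hne
    obtain ⟨b, hb⟩ := hne'
    refine ⟨b, ?_⟩
    obtain ⟨q₁, r₁, h₁⟩ := h.glue hS ha hb r g h.1 (by
          intro p f h0 hab
          simp [Fin.sum_univ_three, hsub, hchi _ he₀, hchi _ (hnc 1 (mt h01 c0)),
            hchi _ (hnc 0 c0)])
    exact ⟨q₁, r₁, _, h₁⟩

/-- Reduction across a port-closed set that every element crosses, by a star-delta transformation: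
the elements `i` and `j` have a common end. -/
lemma glue_of_cross (h : WeakRealizes q r g Y) {S : Set V}
    (hS : ∀ k, (q k).1 ∈ S ↔ (q k).2 ∈ S) (hr : ∀ e, (r e).1 ∈ S ∧ (r e).2 ∉ S)
    {i j : Fin 3} (hij : i ≠ j) (hend : (r i).1 = (r j).1 ∨ (r i).2 = (r j).2) :
    ∃ (b : V) (q₁ r₁ : Fin 3 → {x // x ≠ b} × {x // x ≠ b}) (g₁ : Fin 3 → ℝ),
      WeakRealizes q₁ r₁ g₁ Y := by
  obtain ⟨σ, h0, h1⟩ : ∃ σ : Equiv.Perm (Fin 3), σ 0 = i ∧ σ 1 = j := by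
    revert hij
    clear hend
    decide +revert
  wlog hi : i = 0 ∧ j = 1 generalizing r g i j σ
  · exact this (r := r ∘ σ) (g := g ∘ σ) (i := 0) (j := 1) (h.perm σ) (fun e => hr _) (by simp)
      (by simpa [h0, h1] using hend) 1 rfl rfl ⟨rfl, rfl⟩
  obtain ⟨rfl, rfl⟩ := hi
  -- Element 2 is going to be contracted; `t` joins the two other ends of elements 0 and 1 and is
  -- the third side of the triangle.
  obtain ⟨t, ht⟩ : ∃ t : V × V, ∀ f : V → ℝ, drop f t = drop f (r 0) - drop f (r 1) := by
    rcases hend with he | he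
    · refine ⟨((r 1).2, (r 0).2), fun f => ?_⟩
      simp only [drop, he]
      ring
    · refine ⟨((r 0).1, (r 1).1), fun f => ?_⟩
      simp only [drop, he]
      ring
  have hchi : ∀ e, drop (S.indicator (1 : V → ℝ)) (r e) = 1 := by
    intro e
    simp [drop, (hr e).1, (hr e).2]
  have hsub : ∀ (p : V → ℝ) (c : ℝ) (e : V × V),
      drop (fun x => p x - c * S.indicator 1 x) e = drop p e - c * drop (S.indicator 1) e := by
    intro p c e
    simp only [drop]
    ring
  have p0 := h.1 0
  have p1 := h.1 1
  have p2 := h.1 2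
  refine ⟨(r 2).2, ?_⟩
  obtain ⟨q₁, r₁, h₁⟩ := h.glue hS (hr 2).1 (hr 2).2 ![r 0, r 1, t]
    ![g 0 * g 2 / (g 0 + g 1 + g 2), g 1 * g 2 / (g 0 + g 1 + g 2),
      g 0 * g 1 / (g 0 + g 1 + g 2)] (by
      intro e
      fin_cases e <;> simp <;> positivity) (by
      intro p f h0 hab
      have hf0 : drop f (r 2) = 0 := by simp [drop, hab]
      have hp0 : p (r 2).1 - p (r 2).2 = drop p (r 2) := rfl
      simp only [Fin.sum_univ_three, hsub, hchi, hf0, hp0] at h0 ⊢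
      simp [ht, hchi]
      -- If the sum vanishes, so do all three conductances, and division by zero does no harm.
      by_cases hz : g 0 + g 1 + g 2 = 0
      · have e0 : g 0 = 0 := by linarith
        have e1 : g 1 = 0 := by linarith
        simp [e0, e1]
      · field_simp
        linear_combination (g 0 * drop f (r 0) + g 1 * drop f (r 1)) * h0)
  exact ⟨q₁, r₁, _, h₁⟩

end WeakRealizes

/-! ### Reduction to four nodes -/

namespace WeakRealizes

variable {V : Type} {q r : Fin 3 → V × V} {g : Fin 3 → ℝ} {Y : Matrix (Fin 3) (Fin 3) ℝ}

/-- The port voltages as a linear function of the node potentials. -/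
def portDrop {n : ℕ} (q : Fin n → V × V) : (V → ℝ) →ₗ[ℝ] (Fin n → ℝ) where
  toFun p k := drop p (q k)
  map_add' p p' := by
    funext k
    simp only [drop, Pi.add_apply]
    ring
  map_smul' c p := by
    funext k
    simp only [drop, Pi.smul_apply, smul_eq_mul, RingHom.id_apply]
    ring

lemma finrank_ker_portDrop [Fintype V] (h : WeakRealizes q r g Y) :
    3 + Module.finrank ℝ (LinearMap.ker (portDrop q)) = Fintype.card V := by
  have hsurj : Function.Surjective (portDrop q) := fun v => by
    obtain ⟨p, hp, -⟩ := h.2 v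
    exact ⟨p, funext hp⟩
  have := LinearMap.finrank_range_add_finrank_ker (portDrop q)
  rwa [LinearMap.range_eq_top.2 hsurj, finrank_top, Module.finrank_fin_fun,
    Module.finrank_fintype_fun_eq_card] at this

/-- Constant potentials lie in the kernel of `portDrop q`, so its dimension is at least one. -/
lemma four_le_card [Fintype V] (h : WeakRealizes q r g Y) : 4 ≤ Fintype.card V := by
  have h1 := h.finrank_ker_portDrop
  suffices 0 < Module.finrank ℝ (LinearMap.ker (portDrop q)) by omega
  rw [Module.finrank_pos_iff_exists_ne_zero]
  refine ⟨⟨1, ?_⟩, fun h0 => ?_⟩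
  · rw [LinearMap.mem_ker]
    funext k
    simp [portDrop, drop]
  · have := congrFun (congrArg Subtype.val h0) (q 0).1
    simp at this

/-- The kernel of `portDrop q` has dimension at least two, so it contains a nonconstant potential,
one of whose level sets serves as `S`. -/
lemma exists_portClosed [Fintype V] (h : WeakRealizes q r g Y) (hV : 5 ≤ Fintype.card V) :
    ∃ S : Set V, (∀ k, (q k).1 ∈ S ↔ (q k).2 ∈ S) ∧ S.Nonempty ∧ Sᶜ.Nonempty := by
  have h1 := h.finrank_ker_portDrop
  obtain ⟨f, hf, x, y, hxy⟩ : ∃ f ∈ LinearMap.ker (portDrop q), ∃ x y, f x ≠ f y := by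
    by_contra! hcon
    have hle : LinearMap.ker (portDrop q) ≤ Submodule.span ℝ {(1 : V → ℝ)} := fun f hf => by
      rw [Submodule.mem_span_singleton]
      refine ⟨f (q 0).1, funext fun x => ?_⟩
      simpa using hcon f hf _ x
    have h2 := Submodule.finrank_mono hle
    have h3 := finrank_span_le_card (R := ℝ) ({1} : Set (V → ℝ))
    simp only [Set.toFinset_singleton, Finset.card_singleton] at h3
    omega
  refine ⟨{z | f z = f x}, fun k => ?_, ⟨x, rfl⟩, ⟨y, fun h => hxy h.symm⟩⟩
  have : drop f (q k) = 0 := congrFun (LinearMap.mem_ker.1 hf) k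
  rw [Set.mem_ofPred_eq, Set.mem_ofPred_eq, sub_eq_zero.1 this]

/-- Three distinct nodes are the ends of at least two edges. -/
lemma exists_two_edges {a : Fin 3 → V} (ha : Function.Injective a)
    (ht : ∀ i, ∃ k, (q k).1 = a i ∨ (q k).2 = a i) :
    ∃ k l, k ≠ l ∧ (∃ i, (q k).1 = a i ∨ (q k).2 = a i) ∧
      (∃ i, (q l).1 = a i ∨ (q l).2 = a i) := by
  choose c hc using ht
  by_cases h01 : c 0 = c 1
  · by_cases h02 : c 0 = c 2
    · exfalso
      have h0 := hc 0
      have h1 := hc 1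
      have h2 := hc 2
      rw [← h01] at h1
      rw [← h02] at h2
      have n01 := ha.ne (show (0 : Fin 3) ≠ 1 by decide)
      have n02 := ha.ne (show (0 : Fin 3) ≠ 2 by decide)
      have n12 := ha.ne (show (1 : Fin 3) ≠ 2 by decide)
      rcases h0 with h0 | h0 <;> rcases h1 with h1 | h1 <;> rcases h2 with h2 | h2 <;>
        simp_all
    · exact ⟨_, _, h02, ⟨0, hc 0⟩, ⟨2, hc 2⟩⟩
  · exact ⟨_, _, h01, ⟨0, hc 0⟩, ⟨1, hc 1⟩⟩

/-- The only cut not covered directly has three crossing elements with distinct ends on both sides.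
Three ports cannot reach all six ends, and an end without ports is itself a cut that some element
does not cross. -/
lemma exists_smaller [Fintype V] (h : WeakRealizes q r g Y) (hV : 5 ≤ Fintype.card V) :
    ∃ (b : V) (q₁ r₁ : Fin 3 → {x // x ≠ b} × {x // x ≠ b}) (g₁ : Fin 3 → ℝ),
      WeakRealizes q₁ r₁ g₁ Y := by
  classical
  obtain ⟨S, hS, hne, hne'⟩ := h.exists_portClosed hV
  by_cases hc : ∃ e, (r e).1 ∈ S ↔ (r e).2 ∈ S
  · obtain ⟨e, he⟩ := hc
    exact h.glue_of_not_cross hS hne hne' he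
  push Not at hc
  wlog hor : ∀ e, (r e).1 ∈ S ∧ (r e).2 ∉ S generalizing r
  · refine this (r := fun e => if (r e).1 ∈ S then r e else (r e).swap)
      (h.reorient fun e => ?_) (fun e => ?_) fun e => ?_
    · split_ifs <;> simp
    · have := hc e
      split_ifs
      · exact this
      · rw [Prod.fst_swap, Prod.snd_swap]
        tauto
    · have := hc e
      split_ifs
      · tauto
      · rw [Prod.fst_swap, Prod.snd_swap]
        tauto
  by_cases hend : ∃ i j, i ≠ j ∧ ((r i).1 = (r j).1 ∨ (r i).2 = (r j).2)
  · obtain ⟨i, j, hij, hend⟩ := hend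
    exact h.glue_of_cross hS hor hij hend
  push Not at hend
  have ha : Function.Injective fun i => (r i).1 := fun i j hij => by
    by_contra hne
    exact (hend i j hne).1 hij
  have hb : Function.Injective fun i => (r i).2 := fun i j hij => by
    by_contra hne
    exact (hend i j hne).2 hij
  have hiso : ∀ x : V, (∀ k, (q k).1 ≠ x ∧ (q k).2 ≠ x) → (∃ e, (r e).1 ≠ x ∧ (r e).2 ≠ x) →
      ∃ (b : V) (q₁ r₁ : Fin 3 → {x // x ≠ b} × {x // x ≠ b}) (g₁ : Fin 3 → ℝ),
        WeakRealizes q₁ r₁ g₁ Y := by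
    rintro x hx ⟨e, he⟩
    refine h.glue_of_not_cross (S := {x}) (fun k => by simp [hx k]) ⟨x, rfl⟩
      ⟨(r e).1, he.1⟩ (e₀ := e) (by simp [he])
  by_cases hta : ∀ i, ∃ k, (q k).1 = (r i).1 ∨ (q k).2 = (r i).1
  · by_cases htb : ∀ i, ∃ k, (q k).1 = (r i).2 ∨ (q k).2 = (r i).2
    · exfalso
      -- Each side would need two ports of its own, four in all.
      obtain ⟨k, l, hkl, ⟨i, hi⟩, j, hj⟩ := exists_two_edges ha hta
      obtain ⟨k', l', hkl', ⟨i', hi'⟩, j', hj'⟩ := exists_two_edges hb htb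
      have mem : ∀ k i, (q k).1 = (r i).1 ∨ (q k).2 = (r i).1 → (q k).1 ∈ S := by
        rintro k i (hk | hk)
        · rw [hk]
          exact (hor i).1
        · rw [hS, hk]
          exact (hor i).1
      have nmem : ∀ k i, (q k).1 = (r i).2 ∨ (q k).2 = (r i).2 → (q k).1 ∉ S := by
        rintro k i (hk | hk)
        · rw [hk]
          exact (hor i).2
        · rw [hS, hk]
          exact (hor i).2
      have m1 := mem k i hi
      have m2 := mem l j hj
      have m3 := nmem k' i' hi'
      have m4 := nmem l' j' hj'
      have h1 : k ≠ k' := fun h => m3 (h ▸ m1)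
      have h2 : k ≠ l' := fun h => m4 (h ▸ m1)
      have h3 : l ≠ k' := fun h => m3 (h ▸ m2)
      have h4 : l ≠ l' := fun h => m4 (h ▸ m2)
      omega
    · push Not at htb
      obtain ⟨i, hi⟩ := htb
      obtain ⟨j, hj⟩ := exists_ne i
      exact hiso _ hi ⟨j, fun h => (hor i).2 (h ▸ (hor j).1), fun h => hj (hb h)⟩
  · push Not at hta
    obtain ⟨i, hi⟩ := hta
    obtain ⟨j, hj⟩ := exists_ne i
    exact hiso _ hi ⟨j, fun h => hj (ha h), fun h => (hor j).2 (h ▸ (hor i).1)⟩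

lemma exists_four [Fintype V] (h : WeakRealizes q r g Y) :
    ∃ (q₁ r₁ : Fin 3 → Fin 4 × Fin 4) (g₁ : Fin 3 → ℝ), WeakRealizes q₁ r₁ g₁ Y := by
  classical
  obtain ⟨n, hn⟩ := Nat.exists_eq_add_of_le h.four_le_card
  induction n generalizing V g with
  | zero =>
    let σ : V ≃ Fin 4 := Fintype.equivFinOfCardEq hn
    refine ⟨fun k => Prod.map σ σ (q k), fun e => Prod.map σ σ (r e), g, h.1, fun v => ?_⟩
    obtain ⟨p, hp, hf⟩ := h.2 v
    refine ⟨p ∘ σ.symm, fun k => ?_, fun f => ?_⟩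
    · simpa [drop] using hp k
    · simpa [drop] using hf (f ∘ σ)
  | succ n ih =>
    obtain ⟨b, q₁, r₁, g₁, h₁⟩ := h.exists_smaller (by omega)
    refine ih h₁ ?_
    rw [Fintype.card_subtype_compl, Fintype.card_subtype_eq, hn]
    omega

end WeakRealizes

/-! ### Trees of ports on four nodes -/

lemma drop_swap {V : Type} (f : V → ℝ) (e : V × V) : drop f e.swap = -drop f e := by
  simp [drop]

/-- The six pairs of nodes of the complete graph on four nodes. -/
def nodePair : Fin 6 → Fin 4 × Fin 4 := ![(0, 1), (0, 2), (0, 3), (1, 2), (1, 3), (2, 3)]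

/-- `Y` is the admittance of a network on four nodes with at most three elements whose ports form,
up to orientation, a tree with coordinates `ψ`: across port `k` only the coordinate `k` changes.
The signs `s` are the orientations of the ports and `G` gives the conductances. -/
def TreeForm (ψ : Fin 4 → Fin 3 → ℝ) (Y : Matrix (Fin 3) (Fin 3) ℝ) : Prop :=
  ∃ s : Fin 3 → ℝ, (∀ k, s k = 1 ∨ s k = -1) ∧ ∃ G : Fin 6 → ℝ, (∀ a, 0 ≤ G a) ∧
    3 ≤ (Finset.univ.filter fun a => G a = 0).card ∧
    ∀ k l, Y k l = s k * s l * ∑ a, G a * drop (ψ · k) (nodePair a) * drop (ψ · l) (nodePair a)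

/-- The ports `0`, `1`, `2` join the nodes `1`, `2`, `3` to the node `0`. -/
def starCoord : Fin 4 → Fin 3 → ℝ := ![![0, 0, 0], ![1, 0, 0], ![0, 1, 0], ![0, 0, 1]]

/-- The ports form a path, in the order `0`, `1`, `2`. -/
def pathCoord₁ : Fin 4 → Fin 3 → ℝ := ![![0, 0, 0], ![1, 0, 0], ![1, 1, 0], ![1, 1, 1]]

/-- The ports form a path, in the order `0`, `2`, `1`. -/
def pathCoord₂ : Fin 4 → Fin 3 → ℝ := ![![0, 0, 0], ![1, 0, 0], ![1, 0, 1], ![1, 1, 1]]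

/-- The ports form a path, in the order `1`, `0`, `2`. -/
def pathCoord₀ : Fin 4 → Fin 3 → ℝ := ![![0, 0, 0], ![0, 1, 0], ![1, 1, 0], ![1, 1, 1]]

lemma exists_nodePair : ∀ e : Fin 4 × Fin 4, e.1 ≠ e.2 →
    ∃ a, e = nodePair a ∨ e = (nodePair a).swap := by
  decide

/-- A class with nonzero total weight is hit by `c`. For three elements and six node pairs this
leaves at least three pairs with total zero. -/
lemma sum_fiber_eq_zero {ι κ : Type} [Fintype ι] [Fintype κ] [DecidableEq κ] (c : ι → Option κ)
    (g : ι → ℝ) :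
    Fintype.card κ ≤ Fintype.card ι +
      (Finset.univ.filter fun a => ∑ e, (if c e = some a then g e else 0) = 0).card := by
  classical
  have h1 : (Finset.univ.filter fun a => ¬ ∑ e, (if c e = some a then g e else 0) = 0).card ≤
      Fintype.card ι := by
    rw [← Finset.card_univ, ← Finset.card_image_of_injective _ (Option.some_injective κ)]
    refine (Finset.card_le_card fun x hx => ?_).trans (Finset.card_image_le (f := c))
    simp only [Finset.mem_image, Finset.mem_filter, Finset.mem_univ, true_and] at hx ⊢
    obtain ⟨a, ha, rfl⟩ := hx
    obtain ⟨e, -, he⟩ := Finset.exists_ne_zero_of_sum_ne_zero ha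
    exact ⟨e, by_contra fun h => he (if_neg h)⟩
  have h2 := Finset.card_filter_add_card_filter_not (s := (Finset.univ : Finset κ))
    (fun a => ∑ e, (if c e = some a then g e else 0) = 0)
  rw [Finset.card_univ] at h2
  omega

/-- The potential `p k` puts unit voltage on port `k` and none on the others; `x` places the model
tree in the network. Parallel elements are pooled by node pair, and loops are discarded. -/
lemma WeakRealizes.treeForm {q r : Fin 3 → Fin 4 × Fin 4} {g : Fin 3 → ℝ}
    {Y : Matrix (Fin 3) (Fin 3) ℝ} (h : WeakRealizes q r g Y) {ψ : Fin 4 → Fin 3 → ℝ}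
    (hψ : ψ.Injective) (x : Fin 4 → Fin 4) {p : Fin 3 → Fin 4 → ℝ}
    (hf : ∀ k f, ∑ l, Y l k * drop f (q l) = ∑ e, g e * drop (p k) (r e) * drop f (r e))
    (hp : ∀ k l, drop (p k) (q l) = if l = k then 1 else 0)
    {s : Fin 3 → ℝ} (hs : ∀ k, s k = 1 ∨ s k = -1)
    (hx : ∀ k i, p k (x i) - p k (x 0) = s k * (ψ i k - ψ 0 k)) : TreeForm ψ Y := by
  have hinj : x.Injective := fun i j hij => hψ (funext fun k => by
    have h1 := hx k i
    have h2 := hx k j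
    rw [hij, h2] at h1
    rcases hs k with h | h <;> rw [h] at h1 <;> linarith)
  let σ : Fin 4 ≃ Fin 4 := Equiv.ofBijective x (Finite.injective_iff_bijective.1 hinj)
  have hσ : ∀ y, x (σ.symm y) = y := fun y => σ.apply_symm_apply y
  have hcls : ∀ e, ∃ c : Option (Fin 6), ∀ k l, drop (p k) (r e) * drop (p l) (r e) =
      s k * s l * ∑ a, if c = some a then
        drop (ψ · k) (nodePair a) * drop (ψ · l) (nodePair a) else 0 := by
    intro e
    have hd : ∀ k, drop (p k) (r e) = s k * drop (ψ · k) (σ.symm (r e).1, σ.symm (r e).2) := by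
      intro k
      have h1 := hx k (σ.symm (r e).1)
      have h2 := hx k (σ.symm (r e).2)
      rw [hσ] at h1 h2
      simp only [drop]
      linarith
    by_cases hne : σ.symm (r e).1 = σ.symm (r e).2
    · refine ⟨none, fun k l => ?_⟩
      rw [hd, hne]
      simp [drop]
    · obtain ⟨a, ha | ha⟩ := exists_nodePair (σ.symm (r e).1, σ.symm (r e).2) hne
      · refine ⟨some a, fun k l => ?_⟩
        simp only [hd, ha, Option.some.injEq, Finset.sum_ite_eq, Finset.mem_univ, if_true]
        ring
      · refine ⟨some a, fun k l => ?_⟩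
        simp only [hd, ha, drop_swap, Option.some.injEq, Finset.sum_ite_eq, Finset.mem_univ,
          if_true]
        ring
  choose c hc using hcls
  refine ⟨s, hs, fun a => ∑ e, if c e = some a then g e else 0,
    fun a => Finset.sum_nonneg fun e _ => ?_, ?_, fun k l => ?_⟩
  · split_ifs
    exacts [h.1 e, le_rfl]
  · have := sum_fiber_eq_zero c g
    simp only [Fintype.card_fin] at this
    exact Nat.le_of_add_le_add_left this
  · have h1 : Y k l = ∑ e, g e * (drop (p l) (r e) * drop (p k) (r e)) := by
      -- Testing with the dual potential `p k` isolates one entry of `Y`.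
      have := hf l (p k)
      simp only [hp, mul_ite, mul_one, mul_zero, Finset.sum_ite_eq', Finset.mem_univ,
        if_true] at this
      simpa only [mul_assoc] using this
    rw [h1]
    simp only [hc, Finset.sum_mul, Finset.mul_sum]
    rw [Finset.sum_comm]
    refine Finset.sum_congr rfl fun a _ => Finset.sum_congr rfl fun e _ => ?_
    split_ifs <;> ring

lemma starCoord_injective : starCoord.Injective := by
  intro i j h
  have h0 := congrFun h 0
  have h1 := congrFun h 1
  have h2 := congrFun h 2
  fin_cases i <;> fin_cases j <;> simp_all [starCoord]

lemma pathCoord₁_injective : pathCoord₁.Injective := by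
  intro i j h
  have h0 := congrFun h 0
  have h1 := congrFun h 1
  have h2 := congrFun h 2
  fin_cases i <;> fin_cases j <;> simp_all [pathCoord₁]

lemma pathCoord₂_injective : pathCoord₂.Injective := by
  intro i j h
  have h0 := congrFun h 0
  have h1 := congrFun h 1
  have h2 := congrFun h 2
  fin_cases i <;> fin_cases j <;> simp_all [pathCoord₂]

lemma pathCoord₀_injective : pathCoord₀.Injective := by
  intro i j h
  have h0 := congrFun h 0
  have h1 := congrFun h 1
  have h2 := congrFun h 2
  fin_cases i <;> fin_cases j <;> simp_all [pathCoord₀]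

/-- Along a step from `y` to `x` only the coordinate `k` of `p` changes, and it does so by one. -/
def Joins {V : Type} (p : Fin 3 → V → ℝ) (k : Fin 3) (x y : V) : Prop :=
  ∃ s : ℝ, (s = 1 ∨ s = -1) ∧ ∀ l, p l x - p l y = if l = k then s else 0

lemma Joins.symm {V : Type} {p : Fin 3 → V → ℝ} {k : Fin 3} {x y : V} (h : Joins p k x y) :
    Joins p k y x := by
  obtain ⟨s, hs, h⟩ := h
  refine ⟨-s, by rcases hs with rfl | rfl <;> simp, fun l => ?_⟩
  rw [← neg_sub, h]
  split_ifs <;> simp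

lemma Joins.ne_of_apply {V : Type} {p : Fin 3 → V → ℝ} {k : Fin 3} {x y : V} (h : Joins p k x y) :
    p k x ≠ p k y := by
  obtain ⟨s, hs, h⟩ := h
  have := h k
  rw [if_pos rfl] at this
  intro h'
  rcases hs with rfl | rfl <;> linarith

lemma Joins.apply_eq {V : Type} {p : Fin 3 → V → ℝ} {k l : Fin 3} {x y : V} (h : Joins p k x y)
    (hl : l ≠ k) : p l x = p l y := by
  obtain ⟨s, hs, h⟩ := h
  have := h l
  rw [if_neg hl] at this
  linarith

lemma exists_fourth : ∀ x y z : Fin 4, x ≠ y → x ≠ z → y ≠ z →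
    ∃ w, ∀ u, u = x ∨ u = y ∨ u = z ∨ u = w := by
  decide

/-- Three edges of a tree on four nodes form a star or a path. -/
lemma star_or_path {p : Fin 3 → Fin 4 → ℝ} (hJ : ∀ k, ∃ x y, Joins p k x y) :
    ∃ x₀ x₁ x₂ x₃,
      (Joins p 0 x₁ x₀ ∧ Joins p 1 x₂ x₀ ∧ Joins p 2 x₃ x₀) ∨
      (Joins p 0 x₁ x₀ ∧ Joins p 1 x₂ x₁ ∧ Joins p 2 x₃ x₂) ∨
      (Joins p 0 x₁ x₀ ∧ Joins p 2 x₂ x₁ ∧ Joins p 1 x₃ x₂) ∨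
      (Joins p 1 x₁ x₀ ∧ Joins p 0 x₂ x₁ ∧ Joins p 2 x₃ x₂) := by
  obtain ⟨a, b, h0⟩ := hJ 0
  obtain ⟨c, d, h1⟩ := hJ 1
  obtain ⟨e, f, h2⟩ := hJ 2
  have a0 := h0.ne_of_apply
  have a1 := h0.apply_eq (l := 1) (by decide)
  have a2 := h0.apply_eq (l := 2) (by decide)
  have b0 := h1.apply_eq (l := 0) (by decide)
  have b1 := h1.ne_of_apply
  have b2 := h1.apply_eq (l := 2) (by decide)
  have c2 := h2.ne_of_apply
  have hshare : ∀ a b c : Fin 4, Joins p 0 a b → Joins p 1 c b → ∃ x₀ x₁ x₂ x₃,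
      (Joins p 0 x₁ x₀ ∧ Joins p 1 x₂ x₀ ∧ Joins p 2 x₃ x₀) ∨
      (Joins p 0 x₁ x₀ ∧ Joins p 1 x₂ x₁ ∧ Joins p 2 x₃ x₂) ∨
      (Joins p 0 x₁ x₀ ∧ Joins p 2 x₂ x₁ ∧ Joins p 1 x₃ x₂) ∨
      (Joins p 1 x₁ x₀ ∧ Joins p 0 x₂ x₁ ∧ Joins p 2 x₃ x₂) := by
    intro a b c h0 h1
    have a0 := h0.ne_of_apply
    have a2 := h0.apply_eq (l := 2) (by decide)
    have b0 := h1.apply_eq (l := 0) (by decide)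
    have b1 := h1.ne_of_apply
    have b2 := h1.apply_eq (l := 2) (by decide)
    obtain ⟨w, hw⟩ := exists_fourth a b c (by rintro rfl; exact a0 rfl)
      (by rintro rfl; exact a0 b0) (by rintro rfl; exact b1 rfl)
    -- Port 2 must reach the fourth node, because `p 2` is constant on `a`, `b`, `c`.
    wlog hf : f = w generalizing e f
    · refine this f e h2.symm c2.symm ?_
      rcases hw e with rfl | rfl | rfl | rfl <;> rcases hw f with rfl | rfl | rfl | rfl <;>
        simp_all
    subst hf
    rcases hw e with rfl | rfl | rfl | rfl
    · exact ⟨c, b, e, f, .inr (.inr (.inr ⟨h1.symm, h0, h2.symm⟩))⟩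
    · exact ⟨e, a, c, f, .inl ⟨h0, h1, h2.symm⟩⟩
    · exact ⟨a, b, e, f, .inr (.inl ⟨h0.symm, h1, h2.symm⟩)⟩
    · exact absurd rfl c2
  by_cases hbd : b = d
  · subst hbd
    exact hshare a b c h0 h1
  by_cases hbc : b = c
  · subst hbc
    exact hshare a b d h0 h1.symm
  by_cases had : a = d
  · subst had
    exact hshare b a c h0.symm h1
  by_cases hac : a = c
  · subst hac
    exact hshare b a d h0.symm h1.symm
  have hab : a ≠ b := by
    rintro rfl
    exact a0 rfl
  have hcd : c ≠ d := by
    rintro rfl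
    exact b1 rfl
  -- Ports 0 and 1 are disjoint here, so their ends exhaust the nodes and port 2 links them as the
  -- middle of a path.
  have hall : ∀ u, u = a ∨ u = b ∨ u = c ∨ u = d := by omega
  rcases hall e with rfl | rfl | rfl | rfl <;> rcases hall f with rfl | rfl | rfl | rfl
  · exact absurd rfl c2
  · exact absurd a2 c2
  · exact ⟨b, e, f, d, .inr (.inr (.inl ⟨h0, h2.symm, h1.symm⟩))⟩
  · exact ⟨b, e, f, c, .inr (.inr (.inl ⟨h0, h2.symm, h1⟩))⟩
  · exact absurd a2.symm c2
  · exact absurd rfl c2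
  · exact ⟨a, e, f, d, .inr (.inr (.inl ⟨h0.symm, h2.symm, h1.symm⟩))⟩
  · exact ⟨a, e, f, c, .inr (.inr (.inl ⟨h0.symm, h2.symm, h1⟩))⟩
  · exact ⟨b, f, e, d, .inr (.inr (.inl ⟨h0, h2, h1.symm⟩))⟩
  · exact ⟨a, f, e, d, .inr (.inr (.inl ⟨h0.symm, h2, h1.symm⟩))⟩
  · exact absurd rfl c2
  · exact absurd b2 c2
  · exact ⟨b, f, e, c, .inr (.inr (.inl ⟨h0, h2, h1⟩))⟩
  · exact ⟨a, f, e, c, .inr (.inr (.inl ⟨h0.symm, h2, h1⟩))⟩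
  · exact absurd b2.symm c2
  · exact absurd rfl c2

lemma WeakRealizes.star_or_path_treeForm {q r : Fin 3 → Fin 4 × Fin 4} {g : Fin 3 → ℝ}
    {Y : Matrix (Fin 3) (Fin 3) ℝ} (h : WeakRealizes q r g Y) :
    TreeForm starCoord Y ∨ TreeForm pathCoord₁ Y ∨ TreeForm pathCoord₂ Y ∨
      TreeForm pathCoord₀ Y := by
  have hex : ∀ k, ∃ p : Fin 4 → ℝ, (∀ l, drop p (q l) = if l = k then 1 else 0) ∧
      ∀ f, ∑ l, Y l k * drop f (q l) = ∑ e, g e * drop p (r e) * drop f (r e) := by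
    intro k
    obtain ⟨p, hp, hf⟩ := h.2 (Pi.single k 1)
    refine ⟨p, fun l => by rw [hp, Pi.single_apply], fun f => ?_⟩
    simpa using hf f
  choose p hp hf using hex
  have hJ : ∀ k, ∃ x y, Joins p k x y := fun k =>
    ⟨(q k).1, (q k).2, 1, .inl rfl, fun l => by simpa [drop, eq_comm] using hp l k⟩
  obtain ⟨x₀, x₁, x₂, x₃, H⟩ := star_or_path hJ
  rcases H with ⟨⟨s, hs, j0⟩, ⟨t, ht, j1⟩, u, hu, j2⟩ | ⟨⟨s, hs, j0⟩, ⟨t, ht, j1⟩, u, hu, j2⟩ |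
    ⟨⟨s, hs, j0⟩, ⟨u, hu, j1⟩, t, ht, j2⟩ | ⟨⟨t, ht, j0⟩, ⟨s, hs, j1⟩, u, hu, j2⟩
  · refine .inl (h.treeForm (s := ![s, t, u]) starCoord_injective ![x₀, x₁, x₂, x₃] hf hp
      (by simp [Fin.forall_fin_succ, hs, ht, hu]) fun k i => ?_)
    have := j0 k
    have := j1 k
    have := j2 k
    fin_cases k <;> fin_cases i <;> simp [starCoord] at * <;> linarith
  · refine .inr (.inl (h.treeForm (s := ![s, t, u]) pathCoord₁_injective ![x₀, x₁, x₂, x₃] hf hp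
      (by simp [Fin.forall_fin_succ, hs, ht, hu]) fun k i => ?_))
    have := j0 k
    have := j1 k
    have := j2 k
    fin_cases k <;> fin_cases i <;> simp [pathCoord₁] at * <;> linarith
  · refine .inr (.inr (.inl (h.treeForm (s := ![s, t, u]) pathCoord₂_injective ![x₀, x₁, x₂, x₃]
      hf hp (by simp [Fin.forall_fin_succ, hs, ht, hu]) fun k i => ?_)))
    have := j0 k
    have := j1 k
    have := j2 k
    fin_cases k <;> fin_cases i <;> simp [pathCoord₂] at * <;> linarith
  · refine .inr (.inr (.inr (h.treeForm (s := ![s, t, u]) pathCoord₀_injective ![x₀, x₁, x₂, x₃]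
      hf hp (by simp [Fin.forall_fin_succ, hs, ht, hu]) fun k i => ?_)))
    have := j0 k
    have := j1 k
    have := j2 k
    fin_cases k <;> fin_cases i <;> simp [pathCoord₀] at * <;> linarith

/-! ### Networks built from a tree -/

lemma nodePair_ne (a : Fin 6) : (nodePair a).1 ≠ (nodePair a).2 := by
  revert a
  decide

lemma drop_single_eq_incidence {V : Type} [DecidableEq V] (e : V × V) (x : V) :
    drop (Pi.single x 1) e = ResistiveNetwork.incidence e x := by
  simp [drop, ResistiveNetwork.incidence, Pi.single_apply]

/-- A network whose ports form a spanning tree, with node coordinates `φ`, has an admittance. -/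
lemma ResistiveNetwork.hasAdmittance_of_coord {n : ℕ} (N : ResistiveNetwork n)
    (φ : Fin N.numNodes → Fin n → ℝ) (x₀ : Fin N.numNodes)
    (hφ : ∀ k l, drop (φ · k) (N.port l) = if l = k then 1 else 0)
    (hp : ∀ (p : Fin N.numNodes → ℝ) x, p x = p x₀ + ∑ k, φ x k * drop p (N.port k))
    {Y : Matrix (Fin n) (Fin n) ℝ}
    (hY : ∀ k l, Y k l =
      ∑ e, N.conductance e * drop (φ · k) (N.element e) * drop (φ · l) (N.element e)) :
    N.HasAdmittance Y := by
  have hdrop : ∀ (p : Fin N.numNodes → ℝ) e,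
      drop p e = ∑ k, drop (φ · k) e * drop p (N.port k) := fun p e => by
    conv_lhs => rw [drop, hp p e.1, hp p e.2]
    rw [add_sub_add_left_eq_sub, ← Finset.sum_sub_distrib]
    exact Finset.sum_congr rfl fun k _ => by rw [← sub_mul]; rfl
  have hYv : ∀ (v : Fin n → ℝ) l, (Y *ᵥ v) l = ∑ e, N.conductance e *
      (∑ k, drop (φ · k) (N.element e) * v k) * drop (φ · l) (N.element e) := fun v l => by
    simp only [Matrix.mulVec, dotProduct, hY, Finset.sum_mul, Finset.mul_sum]
    rw [Finset.sum_comm]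
    exact Finset.sum_congr rfl fun e _ => Finset.sum_congr rfl fun k _ => by ring
  intro v i
  constructor
  · rintro ⟨p, j, hv, hj, hk⟩
    funext l
    have h1 := Finset.sum_congr (rfl : (Finset.univ : Finset (Fin N.numNodes)) = Finset.univ)
      (fun x _ => congrArg (· * φ x l) (hk x))
    simp only [Finset.sum_mul] at h1
    rw [Finset.sum_comm] at h1
    conv_rhs at h1 => rw [Finset.sum_comm]
    simp only [mul_assoc, ← Finset.mul_sum, sum_incidence_mul, hφ, mul_ite, mul_one, mul_zero,
      Finset.sum_ite_eq', Finset.mem_univ, if_true] at h1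
    rw [h1, hYv]
    refine Finset.sum_congr rfl fun e _ => ?_
    have h2 : j e = N.conductance e * drop p (N.element e) := hj e
    have h3 : ∀ k, v k = drop p (N.port k) := hv
    rw [h2, hdrop p]
    simp only [h3]
  · rintro rfl
    have hpe : ∀ e, drop (fun x => ∑ k, φ x k * v k) e = ∑ k, drop (φ · k) e * v k := fun e => by
      simp only [drop, sub_mul, Finset.sum_sub_distrib]
    refine ⟨fun x => ∑ k, φ x k * v k, fun e => N.conductance e *
      drop (fun x => ∑ k, φ x k * v k) (N.element e), fun k => ?_, fun e => rfl, fun x => ?_⟩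
    · have := hpe (N.port k)
      simp only [hφ, ite_mul, one_mul, zero_mul, Finset.sum_ite_eq, Finset.mem_univ,
        if_true] at this
      exact this.symm
    · simp only [hYv, ← hpe, ← drop_single_eq_incidence]
      simp only [Finset.sum_mul]
      rw [Finset.sum_comm]
      refine Finset.sum_congr rfl fun e _ => ?_
      -- The current law at `x` follows by expanding the indicator of `x` in its port drops.
      rw [hdrop (Pi.single x 1) (N.element e), Finset.mul_sum]
      exact Finset.sum_congr rfl fun k _ => by ring

/-- The indicator of the component of `x₀` has no drop across any port, so `hp` makes it constant.
-/
lemma ResistiveNetwork.connected_of_coord {n : ℕ} (N : ResistiveNetwork n)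
    (φ : Fin N.numNodes → Fin n → ℝ) (x₀ : Fin N.numNodes)
    (hp : ∀ (p : Fin N.numNodes → ℝ) x, p x = p x₀ + ∑ k, φ x k * drop p (N.port k)) :
    N.augmentedGraph.Connected := by
  classical
  rw [SimpleGraph.connected_iff_exists_forall_reachable]
  refine ⟨x₀, fun x => ?_⟩
  have h := hp (fun y => if N.augmentedGraph.Reachable x₀ y then 1 else 0) x
  have hd : ∀ k, drop (fun y => if N.augmentedGraph.Reachable x₀ y then (1 : ℝ) else 0)
      (N.port k) = 0 := fun k => by
    have hadj : N.augmentedGraph.Adj (N.port k).1 (N.port k).2 := by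
      rw [augmentedGraph, SimpleGraph.fromRel_adj]
      exact ⟨N.port_ne k, .inl (.inl ⟨k, rfl⟩)⟩
    have hiff : N.augmentedGraph.Reachable x₀ (N.port k).1 ↔
        N.augmentedGraph.Reachable x₀ (N.port k).2 :=
      ⟨fun h => h.trans hadj.reachable, fun h => h.trans hadj.symm.reachable⟩
    simp [drop, hiff]
  by_contra hx
  simp [hd, hx] at h

lemma TreeForm.realizable {ψ : Fin 4 → Fin 3 → ℝ} {Y : Matrix (Fin 3) (Fin 3) ℝ}
    (h : TreeForm ψ Y) (t : Fin 3 → Fin 4 × Fin 4) (ht : ∀ k, (t k).1 ≠ (t k).2)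
    (hψ : ∀ k l, drop (ψ · k) (t l) = if l = k then 1 else 0)
    (hp : ∀ (p : Fin 4 → ℝ) x, p x = p 0 + ∑ k, ψ x k * drop p (t k)) :
    RealizableWithAtMost 3 Y := by
  classical
  obtain ⟨s, hs, G, hG, hcard, hY⟩ := h
  -- Only node pairs of nonzero conductance become elements; the signs `s` are absorbed by reversing
  -- ports.
  set S : Finset (Fin 6) := Finset.univ.filter fun a => ¬ G a = 0 with hSdef
  have hScard : S.card ≤ 3 := by
    have := Finset.card_filter_add_card_filter_not (s := (Finset.univ : Finset (Fin 6)))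
      (fun a => G a = 0)
    rw [Finset.card_univ, Fintype.card_fin] at this
    change (Finset.univ.filter fun a => ¬ G a = 0).card ≤ 3
    exact Nat.le_of_add_le_add_left (this.le.trans (Nat.add_le_add_right hcard 3))
  have hSmem : ∀ a : S, G a ≠ 0 := fun a => (Finset.mem_filter.1 a.2).2
  let port : Fin 3 → Fin 4 × Fin 4 := fun k => if s k = 1 then t k else (t k).swap
  have hport : ∀ (p : Fin 4 → ℝ) k, drop p (port k) = s k * drop p (t k) := by
    intro p k
    by_cases h1 : s k = 1
    · simp [port, h1]
    · have h2 : s k = -1 := (hs k).resolve_left h1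
      simp only [port, if_neg h1, drop_swap, h2]
      ring
  let N : ResistiveNetwork 3 :=
    { numNodes := 4
      numElements := S.card
      port := port
      element := fun e => nodePair (S.equivFin.symm e)
      conductance := fun e => G (S.equivFin.symm e)
      port_ne := fun k => by
        by_cases h1 : s k = 1
        · simpa [port, h1] using ht k
        · simpa [port, h1] using (ht k).symm
      element_ne := fun e => nodePair_ne _
      conductance_pos := fun e => lt_of_le_of_ne (hG _) (hSmem _).symm }
  have hsum : ∀ F : Fin 6 → ℝ, (∀ a, G a = 0 → F a = 0) →
      ∑ e, F (S.equivFin.symm e) = ∑ a, F a := fun F hF => by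
    rw [Equiv.sum_comp S.equivFin.symm (fun a : S => F a), Finset.sum_coe_sort S F]
    refine Finset.sum_subset (Finset.subset_univ _) fun a _ ha => hF a ?_
    simpa [hSdef] using ha
  have hss : ∀ k, s k * s k = 1 := fun k => by rcases hs k with h | h <;> rw [h] <;> norm_num
  let φ : Fin 4 → Fin 3 → ℝ := fun x k => s k * ψ x k
  have hφ : ∀ k e, drop (φ · k) e = s k * drop (ψ · k) e := fun k e => by
    simp only [drop, φ]
    ring
  have hpφ : ∀ (p : Fin 4 → ℝ) x, p x = p 0 + ∑ k, φ x k * drop p (port k) := fun p x => by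
    rw [hp p x]
    refine congrArg _ (Finset.sum_congr rfl fun k _ => ?_)
    rw [hport]
    simp only [φ]
    linear_combination (-ψ x k * drop p (t k)) * hss k
  refine ⟨N, N.connected_of_coord φ (0 : Fin 4) hpφ, hScard,
    N.hasAdmittance_of_coord φ (0 : Fin 4) (fun k l => ?_) hpφ fun k l => ?_⟩
  · show drop (φ · k) (port l) = _
    rw [hport, hφ, hψ]
    split_ifs with h
    · rw [h]
      linear_combination hss k
    · simp
  · rw [hY, ← hsum _ (fun a ha => by simp [ha]), Finset.mul_sum]
    refine Finset.sum_congr rfl fun e _ => ?_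
    rw [hφ, hφ]
    simp only [N]
    ring

lemma TreeForm.realizable_star {Y : Matrix (Fin 3) (Fin 3) ℝ} (h : TreeForm starCoord Y) :
    RealizableWithAtMost 3 Y := by
  refine h.realizable ![(1, 0), (2, 0), (3, 0)] (by decide) (fun k l => ?_) fun p x => ?_
  · fin_cases k <;> fin_cases l <;> simp [drop, starCoord]
  · fin_cases x <;> simp [drop, starCoord, Fin.sum_univ_three]

lemma TreeForm.realizable_path₁ {Y : Matrix (Fin 3) (Fin 3) ℝ} (h : TreeForm pathCoord₁ Y) :
    RealizableWithAtMost 3 Y := by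
  refine h.realizable ![(1, 0), (2, 1), (3, 2)] (by decide) (fun k l => ?_) fun p x => ?_
  · fin_cases k <;> fin_cases l <;> simp [drop, pathCoord₁]
  · fin_cases x <;> simp [drop, pathCoord₁, Fin.sum_univ_three]

lemma TreeForm.realizable_path₂ {Y : Matrix (Fin 3) (Fin 3) ℝ} (h : TreeForm pathCoord₂ Y) :
    RealizableWithAtMost 3 Y := by
  refine h.realizable ![(1, 0), (3, 2), (2, 1)] (by decide) (fun k l => ?_) fun p x => ?_
  · fin_cases k <;> fin_cases l <;> simp [drop, pathCoord₂]
  · fin_cases x <;> simp [drop, pathCoord₂, Fin.sum_univ_three]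
    ring

lemma TreeForm.realizable_path₀ {Y : Matrix (Fin 3) (Fin 3) ℝ} (h : TreeForm pathCoord₀ Y) :
    RealizableWithAtMost 3 Y := by
  refine h.realizable ![(2, 1), (1, 0), (3, 2)] (by decide) (fun k l => ?_) fun p x => ?_
  · fin_cases k <;> fin_cases l <;> simp [drop, pathCoord₀]
  · fin_cases x <;> simp [drop, pathCoord₀, Fin.sum_univ_three]

lemma realizable_iff_treeForm {Y : Matrix (Fin 3) (Fin 3) ℝ} :
    RealizableWithAtMost 3 Y ↔ TreeForm starCoord Y ∨ TreeForm pathCoord₁ Y ∨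
      TreeForm pathCoord₂ Y ∨ TreeForm pathCoord₀ Y := by
  constructor
  · rintro ⟨N, -, hm, hN⟩
    obtain ⟨r, g, h⟩ := hN.weakRealizes hm
    obtain ⟨q₁, r₁, g₁, h₁⟩ := h.exists_four
    exact h₁.star_or_path_treeForm
  · rintro (h | h | h | h)
    exacts [h.realizable_star, h.realizable_path₁, h.realizable_path₂, h.realizable_path₀]

/-! ### Solving for the conductances -/

/-- If all three numbers are nonzero, their signs multiply to one, so the third sign is the product
of the other two; a zero entry leaves its sign free. -/
lemma exists_signs {a b c : ℝ} (h : 0 ≤ a * b * c) :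
    ∃ s t u : ℝ, (s = 1 ∨ s = -1) ∧ (t = 1 ∨ t = -1) ∧ (u = 1 ∨ u = -1) ∧
      a = s * t * |a| ∧ b = s * u * |b| ∧ c = t * u * |c| := by
  have key : ∀ x : ℝ, ∃ s : ℝ, (s = 1 ∨ s = -1) ∧ x = s * |x| := fun x => by
    rcases le_total 0 x with hx | hx
    · exact ⟨1, .inl rfl, by rw [abs_of_nonneg hx, one_mul]⟩
    · exact ⟨-1, .inr rfl, by rw [abs_of_nonpos hx]; ring⟩
  have hmul : ∀ s t : ℝ, (s = 1 ∨ s = -1) → (t = 1 ∨ t = -1) → s * t = 1 ∨ s * t = -1 := by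
    rintro s t (rfl | rfl) (rfl | rfl) <;> norm_num
  have hsq : ∀ s : ℝ, (s = 1 ∨ s = -1) → s * s = 1 := by
    rintro s (rfl | rfl) <;> norm_num
  obtain ⟨α, hα, ha⟩ := key a
  obtain ⟨β, hβ, hb⟩ := key b
  obtain ⟨γ, hγ, hc⟩ := key c
  by_cases ha0 : a = 0
  · refine ⟨β, γ, 1, hβ, hγ, .inl rfl, by simp [ha0], by linarith, by linarith⟩
  by_cases hb0 : b = 0
  · refine ⟨α, 1, γ, hα, .inl rfl, hγ, by linarith, by simp [hb0], by linarith⟩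
  by_cases hc0 : c = 0
  · refine ⟨1, α, β, .inl rfl, hα, hβ, by linarith, by linarith, by simp [hc0]⟩
  have hpos : 0 < |a| * |b| * |c| := by positivity
  have hprod : α * β * γ = 1 := by
    rcases hmul _ _ (hmul _ _ hα hβ) hγ with h1 | h1
    · exact h1
    · have : a * b * c = α * β * γ * (|a| * |b| * |c|) := by
        conv_lhs => rw [ha, hb, hc]
        ring
      rw [this, h1] at h
      linarith
  refine ⟨1, α, β, .inl rfl, hα, hβ, by linarith, by linarith, ?_⟩
  have : γ = α * β := by linear_combination (-γ) * hsq _ (hmul _ _ hα hβ) + α * β * hprod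
  rw [← this]
  exact hc

lemma abs_sign_mul {s t x : ℝ} (hs : s = 1 ∨ s = -1) (ht : t = 1 ∨ t = -1) (hx : 0 ≤ x) :
    |s * t * x| = x := by
  rcases hs with rfl | rfl <;> rcases ht with rfl | rfl <;> simp [abs_of_nonneg hx]

lemma sign_prod {s t u : ℝ} (hs : s = 1 ∨ s = -1) (ht : t = 1 ∨ t = -1) (hu : u = 1 ∨ u = -1)
    (x y z : ℝ) : s * t * x * (s * u * y) * (t * u * z) = x * y * z := by
  rcases hs with rfl | rfl <;> rcases ht with rfl | rfl <;> rcases hu with rfl | rfl <;> ring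

/-- `G 3`, `G 4`, `G 5` join two leaves of the star and are the absolute values of the off-diagonal
entries; `G 0`, `G 1`, `G 2` join the centre to a leaf and are what remains of the diagonal. -/
lemma treeForm_starCoord_iff (y11 y12 y13 y22 y23 y33 : ℝ) :
    TreeForm starCoord !![y11, y12, y13; y12, y22, y23; y13, y23, y33] ↔
      (y12 * y13 * y23 ≤ 0 ∧
        0 ≤ y11 - |y12| - |y13| ∧ 0 ≤ y22 - |y12| - |y23| ∧ 0 ≤ y33 - |y13| - |y23| ∧
        AtLeastThreeZero ![y12, y13, y23,
          y11 - |y12| - |y13|, y22 - |y12| - |y23|, y33 - |y13| - |y23|]) := by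
  constructor
  · rintro ⟨s, hs, G, hG, hcard, hY⟩
    have hss : ∀ k, s k * s k = 1 := fun k => by rcases hs k with h | h <;> rw [h] <;> norm_num
    have e11 := hY 0 0
    have e12 := hY 0 1
    have e13 := hY 0 2
    have e22 := hY 1 1
    have e23 := hY 1 2
    have e33 := hY 2 2
    simp [Fin.sum_univ_six, nodePair, drop, starCoord, hss] at e11 e12 e13 e22 e23 e33
    have a12 : |y12| = G 3 := by
      rw [e12, abs_neg]
      exact abs_sign_mul (hs 0) (hs 1) (hG 3)
    have a13 : |y13| = G 4 := by
      rw [e13, abs_neg]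
      exact abs_sign_mul (hs 0) (hs 2) (hG 4)
    have a23 : |y23| = G 5 := by
      rw [e23, abs_neg]
      exact abs_sign_mul (hs 1) (hs 2) (hG 5)
    have r1 : y11 - |y12| - |y13| = G 0 := by linarith
    have r2 : y22 - |y12| - |y23| = G 1 := by linarith
    have r3 : y33 - |y13| - |y23| = G 2 := by linarith
    refine ⟨?_, r1 ▸ hG 0, r2 ▸ hG 1, r3 ▸ hG 2, ?_⟩
    · have := sign_prod (hs 0) (hs 1) (hs 2) (G 3) (G 4) (G 5)
      have hpos : 0 ≤ G 3 * G 4 * G 5 := mul_nonneg (mul_nonneg (hG 3) (hG 4)) (hG 5)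
      rw [e12, e13, e23]
      linarith
    · have z12 : y12 = 0 ↔ G 3 = 0 := by rw [← a12, abs_eq_zero]
      have z13 : y13 = 0 ↔ G 4 = 0 := by rw [← a13, abs_eq_zero]
      have z23 : y23 = 0 ↔ G 5 = 0 := by rw [← a23, abs_eq_zero]
      rw [Finset.card_filter, Fin.sum_univ_six] at hcard
      rw [AtLeastThreeZero, Finset.card_filter, Fin.sum_univ_six]
      simp [r1, r2, r3, z12, z13, z23]
      omega
  · rintro ⟨hprod, h1, h2, h3, hcard⟩
    obtain ⟨s, t, u, hs, ht, hu, e12, e13, e23⟩ :=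
      -- An element between two leaves has opposite drops in their two coordinates, hence the minus
      -- signs.
      exists_signs (a := -y12) (b := -y13) (c := -y23) (by linarith)
    rw [abs_neg] at e12 e13 e23
    have hss : s * s = 1 := by rcases hs with h | h <;> rw [h] <;> norm_num
    have htt : t * t = 1 := by rcases ht with h | h <;> rw [h] <;> norm_num
    have huu : u * u = 1 := by rcases hu with h | h <;> rw [h] <;> norm_num
    refine ⟨![s, t, u], by simp [Fin.forall_fin_succ, hs, ht, hu],
      ![y11 - |y12| - |y13|, y22 - |y12| - |y23|, y33 - |y13| - |y23|, |y12|, |y13|, |y23|],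
      ?_, ?_, fun k l => ?_⟩
    · simp only [Fin.forall_fin_succ]
      simp
      exact ⟨by linarith, by linarith, by linarith⟩
    · rw [AtLeastThreeZero, Finset.card_filter, Fin.sum_univ_six] at hcard
      rw [Finset.card_filter, Fin.sum_univ_six]
      change 3 ≤ (if y12 = 0 then 1 else 0) + (if y13 = 0 then 1 else 0) +
        (if y23 = 0 then 1 else 0) + (if y11 - |y12| - |y13| = 0 then 1 else 0) +
        (if y22 - |y12| - |y23| = 0 then 1 else 0) +
        (if y33 - |y13| - |y23| = 0 then 1 else 0) at hcard
      change 3 ≤ (if y11 - |y12| - |y13| = 0 then 1 else 0) +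
        (if y22 - |y12| - |y23| = 0 then 1 else 0) + (if y33 - |y13| - |y23| = 0 then 1 else 0) +
        (if |y12| = 0 then 1 else 0) + (if |y13| = 0 then 1 else 0) + (if |y23| = 0 then 1 else 0)
      simp only [abs_eq_zero]
      omega
    · fin_cases k <;> fin_cases l <;>
        simp [Fin.sum_univ_six, nodePair, drop, starCoord, hss, htt, huu] <;> linarith

/-- The conductances of a network whose ports form a path exist exactly under the conditions on the
admittance with the middle port `2`. -/
lemma exists_path_conductances_iff (y11 y12 y13 y22 y23 y33 : ℝ) :
    (∃ s t u : ℝ, (s = 1 ∨ s = -1) ∧ (t = 1 ∨ t = -1) ∧ (u = 1 ∨ u = -1) ∧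
      ∃ G : Fin 6 → ℝ, (∀ a, 0 ≤ G a) ∧ 3 ≤ (Finset.univ.filter fun a => G a = 0).card ∧
        y11 = G 0 + G 1 + G 2 ∧ y22 = G 1 + G 2 + G 3 + G 4 ∧ y33 = G 2 + G 4 + G 5 ∧
        y12 = s * t * (G 1 + G 2) ∧ y13 = s * u * G 2 ∧ y23 = t * u * (G 2 + G 4)) ↔
      0 ≤ y12 * y13 * y23 ∧ HoldWithThreeEqualities
            ![-|y13|, |y13|, |y12|, |y13|, |y23|, |y12| + |y23| - |y13|]
            ![0,      |y12|, y11,   |y23|, y33,   y22] := by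
  constructor
  · rintro ⟨s, t, u, hs, ht, hu, G, hG, hcard, e11, e22, e33, e12, e13, e23⟩
    have g0 := hG 0
    have g1 := hG 1
    have g2 := hG 2
    have g3 := hG 3
    have g4 := hG 4
    have g5 := hG 5
    have a12 : |y12| = G 1 + G 2 := by
      rw [e12]
      exact abs_sign_mul hs ht (by positivity)
    have a13 : |y13| = G 2 := by
      rw [e13]
      exact abs_sign_mul hs hu (by positivity)
    have a23 : |y23| = G 2 + G 4 := by
      rw [e23]
      exact abs_sign_mul ht hu (by positivity)
    refine ⟨?_, ?_, ?_⟩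
    · rw [e12, e13, e23, sign_prod hs ht hu]
      positivity
    · have l0 : -|y13| ≤ 0 := by linarith
      have l1 : |y13| ≤ |y12| := by linarith
      have l2 : |y12| ≤ y11 := by linarith
      have l3 : |y13| ≤ |y23| := by linarith
      have l4 : |y23| ≤ y33 := by linarith
      have l5 : |y12| + |y23| - |y13| ≤ y22 := by linarith
      intro k
      fin_cases k
      exacts [l0, l1, l2, l3, l4, l5]
    · rw [Finset.card_filter, Fin.sum_univ_six] at hcard ⊢
      have z0 : -|y13| = 0 ↔ G 2 = 0 := by rw [a13, neg_eq_zero]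
      have z1 : |y13| = |y12| ↔ G 1 = 0 := by constructor <;> intro <;> linarith
      have z2 : |y12| = y11 ↔ G 0 = 0 := by constructor <;> intro <;> linarith
      have z3 : |y13| = |y23| ↔ G 4 = 0 := by constructor <;> intro <;> linarith
      have z4 : |y23| = y33 ↔ G 5 = 0 := by constructor <;> intro <;> linarith
      have z5 : |y12| + |y23| - |y13| = y22 ↔ G 3 = 0 := by constructor <;> intro <;> linarith
      change 3 ≤ (if -|y13| = 0 then 1 else 0) + (if |y13| = |y12| then 1 else 0) +
        (if |y12| = y11 then 1 else 0) + (if |y13| = |y23| then 1 else 0) +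
        (if |y23| = y33 then 1 else 0) + (if |y12| + |y23| - |y13| = y22 then 1 else 0)
      simp only [z0, z1, z2, z3, z4, z5]
      omega
  · rintro ⟨hprod, hle, hcard⟩
    obtain ⟨s, t, u, hs, ht, hu, e12, e13, e23⟩ := exists_signs hprod
    have l0 : -|y13| ≤ 0 := hle 0
    have l1 : |y13| ≤ |y12| := hle 1
    have l2 : |y12| ≤ y11 := hle 2
    have l3 : |y13| ≤ |y23| := hle 3
    have l4 : |y23| ≤ y33 := hle 4
    have l5 : |y12| + |y23| - |y13| ≤ y22 := hle 5
    -- An element contributes to an entry when it spans both ports. The resulting system is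
    -- triangular and is solved starting from `G 2`, which spans all three ports.
    refine ⟨s, t, u, hs, ht, hu, ![y11 - |y12|, |y12| - |y13|, |y13|,
      y22 - (|y12| + |y23| - |y13|), |y23| - |y13|, y33 - |y23|], ?_, ?_, ?_⟩
    · simp only [Fin.forall_fin_succ]
      simp
      refine ⟨?_, ?_, ?_, ?_, ?_⟩ <;> linarith
    · rw [Finset.card_filter, Fin.sum_univ_six] at hcard ⊢
      change 3 ≤ (if -|y13| = 0 then 1 else 0) + (if |y13| = |y12| then 1 else 0) +
        (if |y12| = y11 then 1 else 0) + (if |y13| = |y23| then 1 else 0) +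
        (if |y23| = y33 then 1 else 0) +
        (if |y12| + |y23| - |y13| = y22 then 1 else 0) at hcard
      change 3 ≤ (if y11 - |y12| = 0 then 1 else 0) + (if |y12| - |y13| = 0 then 1 else 0) +
        (if |y13| = 0 then 1 else 0) + (if y22 - (|y12| + |y23| - |y13|) = 0 then 1 else 0) +
        (if |y23| - |y13| = 0 then 1 else 0) + (if y33 - |y23| = 0 then 1 else 0)
      simp only [sub_eq_zero, neg_eq_zero, eq_comm (a := |y13|) (b := |y12|),
        eq_comm (a := |y12|) (b := y11), eq_comm (a := |y13|) (b := |y23|),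
        eq_comm (a := |y23|) (b := y33), eq_comm (b := y22)] at hcard ⊢
      omega
    · simp
      exact ⟨by ring, e12, e13, e23⟩

lemma treeForm_pathCoord₁_iff (y11 y12 y13 y22 y23 y33 : ℝ) :
    TreeForm pathCoord₁ !![y11, y12, y13; y12, y22, y23; y13, y23, y33] ↔
      0 ≤ y12 * y13 * y23 ∧ HoldWithThreeEqualities
            ![-|y13|, |y13|, |y12|, |y13|, |y23|, |y12| + |y23| - |y13|]
            ![0,      |y12|, y11,   |y23|, y33,   y22] := by
  rw [← exists_path_conductances_iff]
  constructor
  · rintro ⟨s, hs, G, hG, hcard, hY⟩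
    have hss : ∀ k, s k * s k = 1 := fun k => by rcases hs k with h | h <;> rw [h] <;> norm_num
    have e11 := hY 0 0
    have e12 := hY 0 1
    have e13 := hY 0 2
    have e22 := hY 1 1
    have e23 := hY 1 2
    have e33 := hY 2 2
    simp [Fin.sum_univ_six, nodePair, drop, pathCoord₁, hss] at e11 e12 e13 e22 e23 e33
    refine ⟨s 0, s 1, s 2, hs 0, hs 1, hs 2, G, hG, hcard, ?_, ?_, ?_, ?_, ?_, ?_⟩ <;> linarith
  · rintro ⟨s, t, u, hs, ht, hu, G, hG, hcard, e11, e22, e33, e12, e13, e23⟩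
    have hss : s * s = 1 := by rcases hs with h | h <;> rw [h] <;> norm_num
    have htt : t * t = 1 := by rcases ht with h | h <;> rw [h] <;> norm_num
    have huu : u * u = 1 := by rcases hu with h | h <;> rw [h] <;> norm_num
    refine ⟨![s, t, u], by simp [Fin.forall_fin_succ, hs, ht, hu], G, hG, hcard, fun k l => ?_⟩
    fin_cases k <;> fin_cases l <;>
      simp [Fin.sum_univ_six, nodePair, drop, pathCoord₁, hss, htt, huu] <;> linarith

lemma treeForm_pathCoord₂_iff (y11 y12 y13 y22 y23 y33 : ℝ) :
    TreeForm pathCoord₂ !![y11, y12, y13; y12, y22, y23; y13, y23, y33] ↔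
      0 ≤ y12 * y13 * y23 ∧ HoldWithThreeEqualities
            ![-|y12|, |y12|, |y13|, |y12|, |y23|, |y13| + |y23| - |y12|]
            ![0,      |y13|, y11,   |y23|, y22,   y33] := by
  -- The case of middle port 2 with the indices 2 and 3 exchanged.
  rw [mul_comm y12, ← exists_path_conductances_iff]
  constructor
  · rintro ⟨s, hs, G, hG, hcard, hY⟩
    have hss : ∀ k, s k * s k = 1 := fun k => by rcases hs k with h | h <;> rw [h] <;> norm_num
    have e11 := hY 0 0
    have e12 := hY 0 1
    have e13 := hY 0 2
    have e22 := hY 1 1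
    have e23 := hY 1 2
    have e33 := hY 2 2
    simp [Fin.sum_univ_six, nodePair, drop, pathCoord₂, hss] at e11 e12 e13 e22 e23 e33
    refine ⟨s 0, s 2, s 1, hs 0, hs 2, hs 1, G, hG, hcard, ?_, ?_, ?_, ?_, ?_, ?_⟩ <;> linarith
  · rintro ⟨s, u, t, hs, hu, ht, G, hG, hcard, e11, e22, e33, e12, e13, e23⟩
    have hss : s * s = 1 := by rcases hs with h | h <;> rw [h] <;> norm_num
    have htt : t * t = 1 := by rcases ht with h | h <;> rw [h] <;> norm_num
    have huu : u * u = 1 := by rcases hu with h | h <;> rw [h] <;> norm_num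
    refine ⟨![s, t, u], by simp [Fin.forall_fin_succ, hs, ht, hu], G, hG, hcard, fun k l => ?_⟩
    fin_cases k <;> fin_cases l <;>
      simp [Fin.sum_univ_six, nodePair, drop, pathCoord₂, hss, htt, huu] <;> linarith

lemma treeForm_pathCoord₀_iff (y11 y12 y13 y22 y23 y33 : ℝ) :
    TreeForm pathCoord₀ !![y11, y12, y13; y12, y22, y23; y13, y23, y33] ↔
      0 ≤ y12 * y13 * y23 ∧ HoldWithThreeEqualities
            ![-|y23|, |y23|, |y12|, |y23|, |y13|, |y12| + |y13| - |y23|]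
            ![0,      |y12|, y22,   |y13|, y33,   y11] := by
  -- The case of middle port 2 with the indices 1 and 2 exchanged.
  rw [mul_right_comm, ← exists_path_conductances_iff]
  constructor
  · rintro ⟨s, hs, G, hG, hcard, hY⟩
    have hss : ∀ k, s k * s k = 1 := fun k => by rcases hs k with h | h <;> rw [h] <;> norm_num
    have e11 := hY 0 0
    have e12 := hY 0 1
    have e13 := hY 0 2
    have e22 := hY 1 1
    have e23 := hY 1 2
    have e33 := hY 2 2
    simp [Fin.sum_univ_six, nodePair, drop, pathCoord₀, hss] at e11 e12 e13 e22 e23 e33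
    refine ⟨s 1, s 0, s 2, hs 1, hs 0, hs 2, G, hG, hcard, ?_, ?_, ?_, ?_, ?_, ?_⟩ <;> linarith
  · rintro ⟨t, s, u, ht, hs, hu, G, hG, hcard, e11, e22, e33, e12, e13, e23⟩
    have hss : s * s = 1 := by rcases hs with h | h <;> rw [h] <;> norm_num
    have htt : t * t = 1 := by rcases ht with h | h <;> rw [h] <;> norm_num
    have huu : u * u = 1 := by rcases hu with h | h <;> rw [h] <;> norm_num
    refine ⟨![s, t, u], by simp [Fin.forall_fin_succ, hs, ht, hu], G, hG, hcard, fun k l => ?_⟩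
    fin_cases k <;> fin_cases l <;>
      simp [Fin.sum_univ_six, nodePair, drop, pathCoord₀, hss, htt, huu] <;> linarith

theorem theorem1 (y11 y12 y13 y22 y23 y33 : ℝ) :
    RealizableWithAtMost 3 !![y11, y12, y13; y12, y22, y23; y13, y23, y33] ↔
      (y12 * y13 * y23 ≤ 0 ∧
        0 ≤ y11 - |y12| - |y13| ∧ 0 ≤ y22 - |y12| - |y23| ∧ 0 ≤ y33 - |y13| - |y23| ∧
        AtLeastThreeZero ![y12, y13, y23,
          y11 - |y12| - |y13|, y22 - |y12| - |y23|, y33 - |y13| - |y23|]) ∨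
      (0 ≤ y12 * y13 * y23 ∧
        (HoldWithThreeEqualities
            ![-|y13|, |y13|, |y12|, |y13|, |y23|, |y12| + |y23| - |y13|]
            ![0,      |y12|, y11,   |y23|, y33,   y22] ∨
          HoldWithThreeEqualities
            ![-|y12|, |y12|, |y13|, |y12|, |y23|, |y13| + |y23| - |y12|]
            ![0,      |y13|, y11,   |y23|, y22,   y33] ∨
          HoldWithThreeEqualities
            ![-|y23|, |y23|, |y12|, |y23|, |y13|, |y12| + |y13| - |y23|]
            ![0,      |y12|, y22,   |y13|, y33,   y11])) := by
  rw [realizable_iff_treeForm, treeForm_starCoord_iff, treeForm_pathCoord₁_iff,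
    treeForm_pathCoord₂_iff, treeForm_pathCoord₀_iff]
  tauto
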